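/- All posets are finite and non-empty. A copy of a poset $Q$ in a poset $P$ is an induced subposet of $P$ isomorphic to $Q$. Let $Q_n$ be the Boolean lattice of dimension $n$, i.e. the subsets of an $n$-element set ordered by inclusion. For posets $P,Q$ let $R(P,Q)$ be the least $N\in\mathbb{N}$ such that every coloring of the elements of $Q_N$ with the colors blue and red contains a blue copy of $P$ or a red copy of $Q$. Let $h(P)$ and $w(P)$ be the largest number of pairwise comparable, respectively pairwise incomparable, elements of $P$, and let $\alpha(m)$ be the least $N$ such that $Q_N$ contains an antichain of size $m$. Let $\Lambda$ be the poset on $z_1,z_2,z_3$ with $z_1>z_2$, $z_1>z_3$ and $z_2,z_3$ incomparable, and let $V$ be the poset on $z_1,z_2,z_3$ with $z_1<z_2$, $z_1<z_3$ and $z_2,z_3$ incomparable. A poset is *trivial* if it contains neither a copy of $\Lambda$ nor a copy of $V$, and *non-trivial* otherwise. Write $\log$ for the logarithm to base $2$. Theorem. Let $P$ be a poset. (0) $P$ is trivial if and only if it is a parallel composition (a disjoint union with no comparabilities between different parts) of one or more non-empty chains. (i) If $P$ is trivial, then for every integer $n\ge 1$, $$n+h(P)-1\le R(P,Q_n)\le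 n+h(P)+\alpha(w(P))-1.$$ In particular $R(P,Q_n)-n=O(1)$ as $n\to\infty$ for fixed $P$; if moreover $|P|\ge 2$, then $R(P,Q_n)=n+\Theta(1)$. (ii) If $P$ is non-trivial, then for every integer $n\ge 2^{16}$, $$R(P,Q_n)\ge n+\frac{1}{15}\cdot\frac{n}{\log n}.$$ Moreover, $R(\Lambda,Q_n)\ge n+\frac{1}{15}\cdot\frac{n}{\log n}$ for every integer $n\ge 2^{16}$. -/

import Mathlib

open Filter Asymptotics

/-- The Boolean lattice `Q_n` of dimension `n`: all subsets of an `n`-element set, ordered by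
inclusion. -/
abbrev BooleanLattice (n : ℕ) : Type := Finset (Fin n)

/-- The two colors. -/
inductive Color where
  | blue
  | red

/-- `P` contains an (induced) copy of `Q`. -/
def ContainsCopy (P Q : Type*) [PartialOrder P] [PartialOrder Q] : Prop :=
  Nonempty (Q ↪o P)

/-- The coloring `c` of `L` contains an (induced) copy of `P` all of whose vertices have
color `k`. -/
def HasMonoCopy {L : Type*} [PartialOrder L] (c : L → Color) (k : Color)
    (P : Type*) [PartialOrder P] : Prop :=
  ∃ f : P ↪o L, ∀ x, c (f x) = k

/-- The poset Ramsey number `R(P, Q)`: the least `N` such that every blue/red coloring of `Q_N`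
contains a blue copy of `P` or a red copy of `Q`. -/
noncomputable def posetRamsey (P Q : Type*) [PartialOrder P] [PartialOrder Q] : ℕ :=
  sInf {N : ℕ | ∀ c : BooleanLattice N → Color,
    HasMonoCopy c Color.blue P ∨ HasMonoCopy c Color.red Q}

/-- The height `h(P)`: the largest number of pairwise comparable vertices of the (finite)
poset `P`. -/
noncomputable def posetHeight (P : Type*) [PartialOrder P] : ℕ :=
  sSup {k : ℕ | ∃ s : Finset P, IsChain (· ≤ ·) (s : Set P) ∧ s.card = k}

/-- The width `w(P)`: the largest number of pairwise incomparable vertices of the (finite)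
poset `P`. -/
noncomputable def posetWidth (P : Type*) [PartialOrder P] : ℕ :=
  sSup {k : ℕ | ∃ s : Finset P, IsAntichain (· ≤ ·) (s : Set P) ∧ s.card = k}

/-- The Sperner number `α(m)`: the least dimension `N` such that `Q_N` contains an antichain of
size `m`. -/
noncomputable def spernerNumber (m : ℕ) : ℕ :=
  sInf {N : ℕ | ∃ s : Finset (BooleanLattice N),
    IsAntichain (· ≤ ·) (s : Set (BooleanLattice N)) ∧ s.card = m}

/-- The 3-element poset `Λ`: `z₁ > z₂`, `z₁ > z₃`, and `z₂`, `z₃` are incomparable. -/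
inductive PosetLambda where
  | z₁
  | z₂
  | z₃

instance : PartialOrder PosetLambda where
  le x y := x = y ∨ y = PosetLambda.z₁
  le_refl _ := Or.inl rfl
  le_trans := by
    rintro x y z (rfl | rfl) (rfl | rfl) <;> simp
  le_antisymm := by
    rintro x y (rfl | rfl) (h | h) <;> simp_all

/-- The 3-element poset `V`: `z₁ < z₂`, `z₁ < z₃`, and `z₂`, `z₃` are incomparable. -/
inductive PosetV where
  | z₁
  | z₂
  | z₃

instance : PartialOrder PosetV where
  le x y := x = y ∨ x = PosetV.z₁
  le_refl _ := Or.inl rfl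
  le_trans := by
    rintro x y z (rfl | rfl) (rfl | rfl) <;> simp
  le_antisymm := by
    rintro x y (rfl | rfl) (h | h) <;> simp_all

/-- A poset is trivial if it contains neither a copy of `Λ` nor a copy of `V`. -/
def IsTrivialPoset (P : Type*) [PartialOrder P] : Prop :=
  ¬ ContainsCopy P PosetLambda ∧ ¬ ContainsCopy P PosetV

/-- `P` is a parallel composition of finitely many (non-empty, finite) chains. The order on the
sigma type is the disjoint-union order: elements of different summands are incomparable. -/
def IsParallelCompositionOfChains (P : Type*) [PartialOrder P] : Prop :=
  ∃ (ℓ : ℕ) (k : Fin ℓ → ℕ), (∀ i, 0 < k i) ∧ Nonempty (P ≃o (Σ i : Fin ℓ, Fin (k i)))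

/-! A poset is trivial exactly when comparability is transitive; its classes are then chains, which
gives (0).

For (i), a coloring of `Q_{n+h}` without a blue chain of `h + 1` vertices has a red `Q_n`
(`hasMonoCopy_fin_or_booleanLattice`): lift each `A` by the length of the longest blue chain found
below it. Copies of `Q_{n+h}` over the members of an antichain make their blue chains incomparable.
The lower bounds color the bottom layers blue.

For (ii), complementation reduces `V` to `Λ`. The coloring of `Q_{n+k}` (`not_posetArrows_lambda`)
must have only chains of blue vertices below each blue vertex, yet meet every copy `φ` of `Q_n` in
blue. Such a `φ` determines an `n`-set `X` on which `φ A` has trace `A`; let `Y` be the complement,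
of size `k`. The blue vertices form, for each `Y`, a tree indexed by repetition-free sequences `S`
in `Y`, the vertex at `S` meeting `Y` exactly in `S`. Climbing this tree along `φ`, each step meets
`φ` or finds a new element of `Y`, which can happen only `k` times. Codes keep distinct branches and
distinct trees incomparable: a bit is written by choosing one of two points, so inclusion forces
equal bits. This takes `8kb` points with `2^b ≥ n + k`, so `k` can be of order `n / log n`. -/

theorem Color.eq_red_of_ne_blue {k : Color} (h : k ≠ Color.blue) : k = Color.red := by
  cases k
  · exact absurd rfl h
  · rfl

theorem HasMonoCopy.of_comp {L L' P : Type*} [PartialOrder L] [PartialOrder L'] [PartialOrder P]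
    {c : L → Color} {k : Color} (f : L' ↪o L) (h : HasMonoCopy (c ∘ f) k P) :
    HasMonoCopy c k P := by
  obtain ⟨g, hg⟩ := h
  exact ⟨g.trans f, hg⟩

theorem HasMonoCopy.mono {L P Q : Type*} [PartialOrder L] [PartialOrder P] [PartialOrder Q]
    {c : L → Color} {k : Color} (f : Q ↪o P) (h : HasMonoCopy c k P) : HasMonoCopy c k Q := by
  obtain ⟨g, hg⟩ := h
  exact ⟨f.trans g, fun x ↦ hg (f x)⟩

/-- Every coloring of `Q_N` contains a blue copy of `P` or a red copy of `Q`. -/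
def PosetArrows (N : ℕ) (P Q : Type*) [PartialOrder P] [PartialOrder Q] : Prop :=
  ∀ c : BooleanLattice N → Color, HasMonoCopy c Color.blue P ∨ HasMonoCopy c Color.red Q

/-! ### The arrow relation and finiteness of the Ramsey number -/

section Arrows

variable {P Q : Type*} [PartialOrder P] [PartialOrder Q] {N M : ℕ}

theorem PosetArrows.of_embedding {α : Type*} (e : α ↪ Fin N)
    (h : ∀ c : Finset α → Color, HasMonoCopy c Color.blue P ∨ HasMonoCopy c Color.red Q) :
    PosetArrows N P Q := fun c ↦
  (h (c ∘ Finset.mapEmbedding e)).imp (HasMonoCopy.of_comp _) (HasMonoCopy.of_comp _)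

theorem PosetArrows.mono (h : PosetArrows N P Q) (hNM : N ≤ M) : PosetArrows M P Q :=
  .of_embedding (Fin.castLEEmb hNM) h

theorem PosetArrows.posetRamsey_le (h : PosetArrows N P Q) : posetRamsey P Q ≤ N :=
  Nat.sInf_le h

/-- Two Boolean lattices have a finite Ramsey number: over each `A ⊆ [m]` sits a copy of `Q_n`,
and these copies are arranged so that choosing one vertex from each yields a copy of `Q_m`. -/
theorem posetArrows_booleanLattice (m n : ℕ) :
    PosetArrows (m + (m + 1) * n) (BooleanLattice m) (BooleanLattice n) := by
  have e : (Fin m ⊕ Fin (m + 1) × Fin n) ≃ Fin (m + (m + 1) * n) :=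
    Fintype.equivFinOfCardEq (by simp)
  refine .of_embedding e.toEmbedding fun c ↦ ?_
  classical
  -- Blocks below `A.card` are full, block `A.card` carries `T`, later ones are empty. Hence `A ⊂
  -- A'` gives inclusion of blobs whatever the `T`s are.
  let blob (A : Finset (Fin m)) (T : Finset (Fin n)) : Finset (Fin m ⊕ Fin (m + 1) × Fin n) :=
    Finset.univ.filter fun z ↦ match z with
      | .inl a => a ∈ A
      | .inr (i, t) => i.val < A.card ∨ (i.val = A.card ∧ t ∈ T)
  by_cases h : ∃ A, ∀ T, c (blob A T) = Color.red
  · obtain ⟨A, hA⟩ := h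
    refine .inr ⟨OrderEmbedding.ofMapLEIff (blob A) fun T T' ↦ ?_, hA⟩
    constructor
    · intro hle t ht
      have hc : A.card < m + 1 := Nat.lt_succ_of_le (by simpa using A.card_le_univ)
      have := @hle (.inr (⟨A.card, hc⟩, t)) (by simp [blob, ht])
      simpa [blob] using this
    · intro hle z hz
      rcases z with a | ⟨i, t⟩
      · simpa [blob] using hz
      · simp only [blob, Finset.mem_filter, Finset.mem_univ, true_and] at hz ⊢
        exact hz.imp_right fun h ↦ ⟨h.1, hle h.2⟩
  · push Not at h
    choose T hT using h
    refine .inl ⟨OrderEmbedding.ofMapLEIff (fun A ↦ blob A (T A)) fun A A' ↦ ?_, fun A ↦ ?_⟩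
    · constructor
      · intro hle a ha
        have := @hle (.inl a) (by simpa [blob] using ha)
        simpa [blob] using this
      · intro hle
        rcases eq_or_ne A A' with rfl | hne
        · exact le_rfl
        have hlt := Finset.card_lt_card (lt_of_le_of_ne hle hne)
        intro z hz
        rcases z with a | ⟨i, t⟩
        · simp only [blob, Finset.mem_filter, Finset.mem_univ, true_and] at hz ⊢
          exact hle hz
        · simp only [blob, Finset.mem_filter, Finset.mem_univ, true_and] at hz ⊢
          omega
    · by_contra hb
      exact hT A (Color.eq_red_of_ne_blue hb)

theorem exists_orderEmbedding_booleanLattice (P : Type*) [PartialOrder P] [Finite P] :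
    Nonempty (P ↪o BooleanLattice (Nat.card P)) := by
  classical
  have := Fintype.ofFinite P
  have e : P ↪ Fin (Nat.card P) := (Finite.equivFin P).toEmbedding
  let f : P ↪o Finset P := OrderEmbedding.ofMapLEIff (fun x ↦ Finset.univ.filter (· ≤ x)) fun x y ↦ by
    constructor
    · intro h
      simpa using @h x (by simp)
    · intro h z hz
      simp only [Finset.mem_filter, Finset.mem_univ, true_and] at hz ⊢
      exact hz.trans h
  exact ⟨f.trans (Finset.mapEmbedding e)⟩

/-- Needed for lower bounds: the infimum of an empty set would be the default value `0`. -/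
theorem exists_posetArrows (P : Type*) [PartialOrder P] [Finite P] (n : ℕ) :
    ∃ N, PosetArrows N P (BooleanLattice n) := by
  obtain ⟨f⟩ := exists_orderEmbedding_booleanLattice P
  exact ⟨_, fun c ↦ (posetArrows_booleanLattice (Nat.card P) n c).imp_left (.mono f)⟩

theorem lt_posetRamsey [Finite P] {n : ℕ} (h : ¬ PosetArrows N P (BooleanLattice n)) :
    N < posetRamsey P (BooleanLattice n) := by
  by_contra! hle
  exact h (PosetArrows.mono (Nat.sInf_mem (exists_posetArrows P n)) hle)

end Arrows

/-! ### Height, width and Sperner number -/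

theorem card_le_posetHeight {P : Type*} [PartialOrder P] [Finite P] (s : Finset P)
    (hs : IsChain (· ≤ ·) (s : Set P)) : s.card ≤ posetHeight P := by
  have := Fintype.ofFinite P
  refine le_csSup ⟨Fintype.card P, ?_⟩ ⟨s, hs, rfl⟩
  rintro _ ⟨t, -, rfl⟩
  exact t.card_le_univ

theorem card_le_posetWidth {P : Type*} [PartialOrder P] [Finite P] (s : Finset P)
    (hs : IsAntichain (· ≤ ·) (s : Set P)) : s.card ≤ posetWidth P := by
  have := Fintype.ofFinite P
  refine le_csSup ⟨Fintype.card P, ?_⟩ ⟨s, hs, rfl⟩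
  rintro _ ⟨t, -, rfl⟩
  exact t.card_le_univ

theorem exists_card_eq_posetHeight (P : Type*) [PartialOrder P] [Finite P] :
    ∃ s : Finset P, IsChain (· ≤ ·) (s : Set P) ∧ s.card = posetHeight P := by
  have := Fintype.ofFinite P
  refine Nat.sSup_mem (s := {k : ℕ | ∃ s : Finset P, IsChain (· ≤ ·) (s : Set P) ∧ s.card = k})
    ⟨0, ∅, by simp, rfl⟩ ⟨Fintype.card P, ?_⟩
  rintro _ ⟨t, -, rfl⟩
  exact t.card_le_univ

theorem posetHeight_pos (P : Type*) [PartialOrder P] [Finite P] [Nonempty P] :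
    0 < posetHeight P := by
  obtain ⟨x⟩ := ‹Nonempty P›
  simpa [Nat.one_le_iff_ne_zero, pos_iff_ne_zero] using card_le_posetHeight {x} (by simp)

theorem exists_antichain_spernerNumber (m : ℕ) :
    ∃ s : Finset (BooleanLattice (spernerNumber m)),
      IsAntichain (· ≤ ·) (s : Set (BooleanLattice (spernerNumber m))) ∧ s.card = m := by
  refine Nat.sInf_mem (s := {N : ℕ | ∃ s : Finset (BooleanLattice N),
    IsAntichain (· ≤ ·) (s : Set (BooleanLattice N)) ∧ s.card = m})
    ⟨m, Finset.univ.image fun i ↦ {i}, ?_, ?_⟩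
  · intro a ha b hb hab
    simp only [Finset.coe_image, Finset.coe_univ, Set.image_univ, Set.mem_range] at ha hb
    obtain ⟨i, rfl⟩ := ha
    obtain ⟨j, rfl⟩ := hb
    simpa using hab
  · rw [Finset.card_image_of_injective _ Finset.singleton_injective]
    simp

/-! ### Trivial posets are parallel compositions of chains -/

section Trivial

variable {P : Type*} [PartialOrder P]

theorem containsCopy_lambda_iff :
    ContainsCopy P PosetLambda ↔ ∃ a b c : P, b ≤ a ∧ c ≤ a ∧ ¬ b ≤ c ∧ ¬ c ≤ b := by
  constructor
  · rintro ⟨f⟩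
    refine ⟨f .z₁, f .z₂, f .z₃, ?_, ?_, ?_, ?_⟩ <;> rw [f.le_iff_le]
    · exact .inr rfl
    · exact .inr rfl
    · rintro (h | h) <;> cases h
    · rintro (h | h) <;> cases h
  · rintro ⟨a, b, c, hb, hc, hbc, hcb⟩
    have hab : ¬ a ≤ b := fun h ↦ hcb (hc.trans h)
    have hac : ¬ a ≤ c := fun h ↦ hbc (hb.trans h)
    refine ⟨OrderEmbedding.ofMapLEIff
      (fun z ↦ match z with | .z₁ => a | .z₂ => b | .z₃ => c) fun x y ↦ ?_⟩
    change _ ↔ x = y ∨ y = PosetLambda.z₁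
    cases x <;> cases y <;> simp [*]

theorem containsCopy_v_iff :
    ContainsCopy P PosetV ↔ ∃ a b c : P, a ≤ b ∧ a ≤ c ∧ ¬ b ≤ c ∧ ¬ c ≤ b := by
  constructor
  · rintro ⟨f⟩
    refine ⟨f .z₁, f .z₂, f .z₃, ?_, ?_, ?_, ?_⟩ <;> rw [f.le_iff_le]
    · exact .inr rfl
    · exact .inr rfl
    · rintro (h | h) <;> cases h
    · rintro (h | h) <;> cases h
  · rintro ⟨a, b, c, hb, hc, hbc, hcb⟩
    have hab : ¬ b ≤ a := fun h ↦ hbc (h.trans hc)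
    have hac : ¬ c ≤ a := fun h ↦ hcb (h.trans hb)
    refine ⟨OrderEmbedding.ofMapLEIff
      (fun z ↦ match z with | .z₁ => a | .z₂ => b | .z₃ => c) fun x y ↦ ?_⟩
    change _ ↔ x = y ∨ x = PosetV.z₁
    cases x <;> cases y <;> simp [*]

theorem nonempty_orderIso_fin_of_total [Finite P] (h : ∀ x y : P, x ≤ y ∨ y ≤ x) :
    Nonempty (P ≃o Fin (Nat.card P)) := by
  classical
  have := Fintype.ofFinite P
  let _ : LinearOrder P :=
    { ‹PartialOrder P› with
      le_total := h
      toDecidableLE := Classical.decRel _ }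
  exact ⟨(Fintype.orderIsoFinOfCardEq P (Nat.card_eq_fintype_card).symm).symm⟩

/-- If `y` lies above both or below both, incomparable `x`, `z` would form a `Λ` or a `V` with it.
-/
theorem IsTrivialPoset.total_trans (h : IsTrivialPoset P) {x y z : P} (hxy : x ≤ y ∨ y ≤ x)
    (hyz : y ≤ z ∨ z ≤ y) : x ≤ z ∨ z ≤ x := by
  obtain ⟨h₁, h₂⟩ := h
  rw [containsCopy_lambda_iff] at h₁
  rw [containsCopy_v_iff] at h₂
  push Not at h₁ h₂
  rcases hxy with hxy | hxy <;> rcases hyz with hyz | hyz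
  · exact .inl (hxy.trans hyz)
  · exact or_iff_not_imp_left.2 (h₁ y x z hxy hyz)
  · exact or_iff_not_imp_left.2 (h₂ y x z hxy hyz)
  · exact .inr (hyz.trans hxy)

theorem IsTrivialPoset.isParallelCompositionOfChains [Finite P] (h : IsTrivialPoset P) :
    IsParallelCompositionOfChains P := by
  let s : Setoid P :=
    { r := fun x y ↦ x ≤ y ∨ y ≤ x
      iseqv := ⟨fun x ↦ .inl le_rfl, Or.symm, h.total_trans⟩ }
  let p : P → Fin (Nat.card (Quotient s)) := fun x ↦ Finite.equivFin _ (Quotient.mk s x)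
  have hp {x y : P} : p x = p y ↔ (x ≤ y ∨ y ≤ x) :=
    (Finite.equivFin (Quotient s)).apply_eq_iff_eq.trans Quotient.eq
  have hg (i) : Nonempty ({x // p x = i} ≃o Fin (Nat.card {x // p x = i})) :=
    nonempty_orderIso_fin_of_total fun x y ↦ hp.1 (x.2.trans y.2.symm)
  let g (i) := (hg i).some
  refine ⟨_, fun i ↦ Nat.card {x // p x = i}, fun i ↦ ?_, ⟨OrderIso.symm
    { toEquiv := (Equiv.sigmaCongrRight fun i ↦ (g i).symm.toEquiv).trans
        (Equiv.sigmaFiberEquiv p)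
      map_rel_iff' := ?_ }⟩⟩
  · obtain ⟨q, hq⟩ := (Finite.equivFin (Quotient s)).surjective i
    obtain ⟨x, rfl⟩ := Quotient.exists_rep q
    have : Nonempty {x // p x = i} := ⟨⟨x, hq⟩⟩
    exact Nat.card_pos
  · rintro ⟨i, a⟩ ⟨j, b⟩
    change ((g i).symm a : P) ≤ ((g j).symm b : P) ↔ _
    constructor
    · intro hle
      obtain rfl : i = j := by
        rw [← ((g i).symm a).2, ← ((g j).symm b).2]
        exact hp.2 (.inl hle)
      exact Sigma.mk_le_mk_iff.2 ((g i).symm.le_iff_le.1 hle)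
    · rintro ⟨i, a, b, hab⟩
      exact (g i).symm.le_iff_le.2 hab

theorem sigma_fst_eq_of_le {ι : Type*} {α : ι → Type*} [∀ i, LE (α i)] {a b : Σ i, α i}
    (h : a ≤ b) : a.1 = b.1 := by
  cases h
  rfl

theorem sigma_total_of_fst_eq {ι : Type*} {α : ι → Type*} [∀ i, LinearOrder (α i)]
    {a b : Σ i, α i} (h : a.1 = b.1) : a ≤ b ∨ b ≤ a := by
  obtain ⟨i, a⟩ := a
  obtain ⟨j, b⟩ := b
  obtain rfl : i = j := h
  simpa only [Sigma.mk_le_mk_iff] using le_total a b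

theorem IsParallelCompositionOfChains.isTrivialPoset (h : IsParallelCompositionOfChains P) :
    IsTrivialPoset P := by
  obtain ⟨ℓ, k, -, ⟨e⟩⟩ := h
  rw [IsTrivialPoset, containsCopy_lambda_iff, containsCopy_v_iff]
  constructor
  · rintro ⟨a, b, c, hb, hc, hbc, hcb⟩
    rw [← e.le_iff_le] at hb hc hbc hcb
    exact (sigma_total_of_fst_eq ((sigma_fst_eq_of_le hb).trans (sigma_fst_eq_of_le hc).symm)).elim
      hbc hcb
  · rintro ⟨a, b, c, hb, hc, hbc, hcb⟩
    rw [← e.le_iff_le] at hb hc hbc hcb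
    exact (sigma_total_of_fst_eq ((sigma_fst_eq_of_le hb).symm.trans (sigma_fst_eq_of_le hc))).elim
      hbc hcb

end Trivial

/-! ### Upper bound for parallel compositions of chains -/

theorem disjSum_le_disjSum_iff {α β : Type*} {s s' : Finset α} {t t' : Finset β} :
    s.disjSum t ≤ s'.disjSum t' ↔ s ⊆ s' ∧ t ⊆ t' := by
  simp [Finset.subset_iff]

/-- Any coloring of `Q_{n+h}` contains a blue chain of length `h + 1` or a red copy of `Q_n`. -/
theorem hasMonoCopy_fin_or_booleanLattice {n h : ℕ} (c : Finset (Fin n ⊕ Fin h) → Color) :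
    HasMonoCopy c Color.blue (Fin (h + 1)) ∨ HasMonoCopy c Color.red (BooleanLattice n) := by
  classical
  let W (A : Finset (Fin n)) (j : ℕ) : Finset (Fin n ⊕ Fin h) :=
    A.disjSum (Finset.univ.filter fun i ↦ i.val < j)
  have hW {A A' : Finset (Fin n)} {j j' : ℕ} (hA : A ⊆ A') (hj : j ≤ j') : W A j ≤ W A' j' :=
    disjSum_le_disjSum_iff.2 ⟨hA, Finset.monotone_filter_right _ fun i _ hi ↦ hi.trans_le hj⟩
  -- A blue chain of `j` vertices, the `i`-th at level `i`, with all first parts inside `A`.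
  let D (j : ℕ) (A : Finset (Fin n)) : Prop := ∃ B : ℕ → Finset (Fin n), Monotone B ∧
    (∀ i < j, c (W (B i) i) = Color.blue) ∧ ∀ i < j, B i ⊆ A
  have hD0 (A) : D 0 A := ⟨fun _ ↦ ∅, monotone_const, by simp, by simp⟩
  have hDs (j A) (hj : D j A) (hb : c (W A j) = Color.blue) : D (j + 1) A := by
    obtain ⟨B, hB, hBc, hBA⟩ := hj
    refine ⟨fun i ↦ if i < j then B i else A, ?_, ?_, ?_⟩
    · intro i i' hi
      by_cases hi' : i' < j
      · simpa [hi', hi.trans_lt hi'] using hB hi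
      · by_cases hij : i < j
        · simpa [hi', hij] using hBA i hij
        · simp [hi', hij]
    · intro i hi
      rcases Nat.lt_succ_iff_lt_or_eq.1 hi with hi | rfl
      · simpa [hi] using hBc i hi
      · simpa using hb
    · intro i hi
      rcases Nat.lt_succ_iff_lt_or_eq.1 hi with hi | rfl
      · simpa [hi] using hBA i hi
      · simp
  by_cases hlong : ∃ A, D (h + 1) A
  · obtain ⟨A, B, hB, hBc, -⟩ := hlong
    refine .inl ⟨OrderEmbedding.ofMapLEIff (fun i : Fin (h + 1) ↦ W (B i) i) fun i j ↦ ?_,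
      fun i ↦ hBc i i.2⟩
    constructor
    · intro hle
      by_contra hij
      rw [not_le] at hij
      have hjh : j.val < h := by omega
      have hsub := (disjSum_le_disjSum_iff.1 hle).2
      have := @hsub (⟨j, hjh⟩ : Fin h) (by simpa using hij)
      simp at this
    · exact fun hij ↦ hW (hB hij) hij
  · push Not at hlong
    -- By maximality `W A (ℓ A)` is red: were it blue, it would extend the chain.
    let ℓ (A : Finset (Fin n)) : ℕ := Nat.findGreatest (D · A) h
    have hℓ (A) : D (ℓ A) A := Nat.findGreatest_spec (P := (D · A)) (Nat.zero_le h) (hD0 A)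
    have hmono {A A' : Finset (Fin n)} (hA : A ⊆ A') : ℓ A ≤ ℓ A' := by
      refine Nat.le_findGreatest (Nat.findGreatest_le _) ?_
      obtain ⟨B, hB, hBc, hBA⟩ := hℓ A
      exact ⟨B, hB, hBc, fun i hi ↦ (hBA i hi).trans hA⟩
    refine .inr ⟨OrderEmbedding.ofMapLEIff (fun A ↦ W A (ℓ A)) fun A A' ↦
      ⟨fun hle ↦ (disjSum_le_disjSum_iff.1 hle).1, fun hA ↦ hW hA (hmono hA)⟩, fun A ↦ ?_⟩
    by_contra hb
    have hb : c (W A (ℓ A)) = Color.blue := by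
      cases hc : c (W A (ℓ A))
      · rfl
      · exact absurd hc hb
    have hs := hDs _ _ (hℓ A) hb
    rcases (Nat.findGreatest_le h : ℓ A ≤ h).lt_or_eq with hlt | heq
    · exact absurd (Nat.le_findGreatest hlt hs) (Nat.not_succ_le_self _)
    · exact hlong A (heq ▸ hs)

section Bounds

variable {P : Type*} [PartialOrder P] [Finite P]

theorem IsParallelCompositionOfChains.posetArrows [Nonempty P]
    (hP : IsParallelCompositionOfChains P) (n : ℕ) :
    PosetArrows (n + posetHeight P + spernerNumber (posetWidth P) - 1) P (BooleanLattice n) := by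
  classical
  obtain ⟨ℓ, k, hk, ⟨e⟩⟩ := hP
  have hℓ : ℓ ≤ posetWidth P := by
    have hinj : Function.Injective fun i : Fin ℓ ↦ e.symm ⟨i, ⟨0, hk i⟩⟩ := fun i j hij ↦
      congrArg Sigma.fst (e.symm.injective hij)
    rw [← Fintype.card_fin ℓ, ← Finset.card_univ, ← Finset.card_image_of_injective _ hinj]
    refine card_le_posetWidth _ ?_
    simp only [Finset.coe_image, Finset.coe_univ, Set.image_univ]
    rintro _ ⟨i, rfl⟩ _ ⟨j, rfl⟩ hne hle
    obtain rfl : i = j := sigma_fst_eq_of_le (e.symm.le_iff_le.1 hle)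
    exact hne rfl
  have hkh (i) : k i ≤ posetHeight P := by
    have hinj : Function.Injective fun j : Fin (k i) ↦ e.symm ⟨i, j⟩ := fun j j' hj ↦ by
      simpa using e.symm.injective hj
    rw [← Fintype.card_fin (k i), ← Finset.card_univ, ← Finset.card_image_of_injective _ hinj]
    refine card_le_posetHeight _ ?_
    simp only [Finset.coe_image, Finset.coe_univ, Set.image_univ]
    rintro _ ⟨j, rfl⟩ _ ⟨j', rfl⟩ -
    simp only [e.symm.le_iff_le]
    exact sigma_total_of_fst_eq rfl
  obtain ⟨h, hh⟩ : ∃ h, posetHeight P = h + 1 :=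
    Nat.exists_eq_succ_of_ne_zero (posetHeight_pos P).ne'
  rw [hh] at hkh ⊢
  -- There are at most `w(P)` chains, so each gets its own member of the antichain as a base set.
  obtain ⟨s, hs, hsc⟩ := exists_antichain_spernerNumber (posetWidth P)
  obtain ⟨T⟩ : Nonempty (Fin ℓ ↪ s) :=
    Function.Embedding.nonempty_of_card_le (by simpa [hsc] using hℓ)
  have E : Fin (spernerNumber (posetWidth P)) ⊕ (Fin n ⊕ Fin h) ≃
      Fin (n + (h + 1) + spernerNumber (posetWidth P) - 1) :=
    Fintype.equivFinOfCardEq (by simp; omega)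
  refine .of_embedding E.toEmbedding fun c ↦ ?_
  let F (i : Fin ℓ) : Finset (Fin n ⊕ Fin h) ↪o
      Finset (Fin (spernerNumber (posetWidth P)) ⊕ (Fin n ⊕ Fin h)) :=
    OrderEmbedding.ofMapLEIff (fun U ↦ (T i : Finset _).disjSum U) fun U U' ↦ by
      simp [disjSum_le_disjSum_iff]
  by_cases hred : ∃ i, HasMonoCopy (c ∘ F i) Color.red (BooleanLattice n)
  · obtain ⟨i, hi⟩ := hred
    exact .inr (hi.of_comp _)
  · push Not at hred
    choose f hf using fun i ↦ (hasMonoCopy_fin_or_booleanLattice (c ∘ F i)).resolve_right (hred i)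
    refine .inl (HasMonoCopy.mono e.toOrderEmbedding ⟨OrderEmbedding.ofMapLEIff
      (fun x : Σ i, Fin (k i) ↦ F x.1 (f x.1 (Fin.castLE (hkh x.1) x.2))) ?_, fun x ↦ hf _ _⟩)
    rintro ⟨i, a⟩ ⟨j, b⟩
    constructor
    · intro hle
      obtain rfl : i = j := by
        by_contra hij
        exact hs (T i).2 (T j).2 (fun h ↦ hij (T.injective (Subtype.ext h)))
          (disjSum_le_disjSum_iff.1 hle).1
      simpa using hle
    · rintro ⟨i, a, b, hab⟩
      simpa using hab

/-! ### Lower bounds from coloring bottom layers -/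

theorem card_add_le_of_strictMono {α : Type*} {g : Finset α → ℕ} (hg : StrictMono g)
    (A : Finset α) : g ∅ + A.card ≤ g A := by
  classical
  induction A using Finset.induction_on with
  | empty => simp
  | insert a A ha ih =>
    have := hg (Finset.ssubset_insert ha)
    rw [Finset.card_insert_of_notMem ha]
    omega

/-- Coloring the lowest `h(P) - 1` layers blue leaves too few red layers for `Q_n`. -/
theorem height_le_posetRamsey [Nonempty P] {n : ℕ} (hn : 1 ≤ n) :
    n + posetHeight P - 1 ≤ posetRamsey P (BooleanLattice n) := by
  classical
  have hpos := posetHeight_pos P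
  have key : ¬ PosetArrows (n + posetHeight P - 2) P (BooleanLattice n) := by
    intro h
    rcases h fun A ↦ if A.card < posetHeight P - 1 then .blue else .red with ⟨f, hf⟩ | ⟨f, hf⟩
    · obtain ⟨s, hs, hsc⟩ := exists_card_eq_posetHeight P
      have hcard : StrictMono fun x ↦ (f x).card := fun x y hxy ↦
        Finset.card_lt_card (f.strictMono hxy)
      have := Finset.card_le_card_of_injOn (s := s) (t := Finset.range (posetHeight P - 1))
        (fun x ↦ (f x).card) (fun x _ ↦ by simpa [Nat.lt_sub_iff_add_lt] using hf x) fun x hx y hy hxy ↦ by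
          by_contra hne
          rcases hs hx hy hne with hle | hle
          · exact (hcard (lt_of_le_of_ne hle hne)).ne hxy
          · exact (hcard (lt_of_le_of_ne hle (Ne.symm hne))).ne' hxy
      simp only [Finset.card_range] at this
      omega
    · have h1 := card_add_le_of_strictMono (g := fun A ↦ (f A).card)
        (fun x y hxy ↦ Finset.card_lt_card (f.strictMono hxy)) Finset.univ
      have h2 : posetHeight P - 1 ≤ (f ∅).card := by simpa using hf ∅
      have h3 := (f Finset.univ).card_le_univ
      simp only [Finset.card_univ, Fintype.card_fin] at h1 h3
      omega
  have := lt_posetRamsey key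
  omega

/-- Coloring only the bottom element blue shows `R(P, Q_n) > n` unless `P` is a single vertex. -/
theorem lt_posetRamsey_of_two_le_card (hP : 2 ≤ Nat.card P) (n : ℕ) :
    n < posetRamsey P (BooleanLattice n) := by
  classical
  refine lt_posetRamsey fun h ↦ ?_
  rcases h fun A ↦ if A = ∅ then .blue else .red with ⟨f, hf⟩ | ⟨f, hf⟩
  · obtain ⟨x, y, hxy⟩ := Finite.one_lt_card_iff_nontrivial.1 hP
    have hf' (x) : f x = ∅ := by simpa using hf x
    exact hxy (f.injective ((hf' x).trans (hf' y).symm))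
  · obtain ⟨A, hA⟩ := Finite.surjective_of_injective f.injective ∅
    simpa [hA] using hf A

end Bounds

/-! ### Codes with large minimum distance -/

section Code

variable {α ι : Type*} [Fintype α] [DecidableEq α]

/-- A set of at most `t` elements is determined by the list of its elements, padded with `none` to
length `t`. -/
theorem card_filter_card_le (t : ℕ) :
    (Finset.univ.filter fun s : Finset α ↦ s.card ≤ t).card ≤ (Fintype.card α + 1) ^ t := by
  have h := Finset.card_le_card_of_injOn (s := Finset.univ.filter fun s : Finset α ↦ s.card ≤ t)
    (t := (Finset.univ : Finset (Fin t → Option α))) (fun s i ↦ s.toList[i.val]?) (by simp) ?_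
  · simpa using h
  · intro s hs s' hs' h
    simp only [Finset.coe_filter, Finset.mem_univ, true_and, Set.mem_ofPred_eq] at hs hs'
    rw [← s.toList_toFinset, ← s'.toList_toFinset]
    refine congrArg List.toFinset (List.ext_getElem? fun i ↦ ?_)
    rcases lt_or_ge i t with hi | hi
    · exact congrFun h ⟨i, hi⟩
    · rw [List.getElem?_eq_none (by simpa using hs.trans hi),
        List.getElem?_eq_none (by simpa using hs'.trans hi)]

theorem card_filter_card_symmDiff_le (D : Finset α) (t : ℕ) :
    (Finset.univ.filter fun s : Finset α ↦ (symmDiff D s).card ≤ t).card ≤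
      (Fintype.card α + 1) ^ t := by
  refine le_trans (Finset.card_le_card_of_injOn (symmDiff D) (fun s hs ↦ ?_)
    (symmDiff_right_injective D).injOn) (card_filter_card_le (α := α) t)
  simpa using hs

/-- The Gilbert–Varshamov bound. -/
theorem exists_code_finset (t M : ℕ) (h : M * (Fintype.card α + 1) ^ t ≤ 2 ^ Fintype.card α) :
    ∃ C : Finset (Finset α), C.card = M ∧
      (C : Set (Finset α)).Pairwise fun D D' ↦ t < (symmDiff D D').card := by
  induction M with
  | zero => exact ⟨∅, by simp⟩
  | succ M ih =>
    have hpos : 0 < (Fintype.card α + 1) ^ t := by positivity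
    rw [add_mul, one_mul] at h
    obtain ⟨C, hC, hCd⟩ := ih (by omega)
    -- Greedy choice: the balls of radius `t` around the codewords so far do not cover everything.
    let U : Finset (Finset α) :=
      C.biUnion fun D ↦ Finset.univ.filter fun s ↦ (symmDiff D s).card ≤ t
    have hU : U.card < (Finset.univ : Finset (Finset α)).card := by
      refine (Finset.card_biUnion_le_card_mul _ _ _
        fun D _ ↦ card_filter_card_symmDiff_le D t).trans_lt ?_
      rw [hC, Finset.card_univ, Fintype.card_finset]
      omega
    obtain ⟨s, -, hs⟩ := Finset.exists_mem_notMem_of_card_lt_card hU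
    simp only [U, Finset.mem_biUnion, Finset.mem_filter, Finset.mem_univ, true_and, not_exists,
      not_and, not_le] at hs
    have hsC : s ∉ C := fun hmem ↦ by simpa using hs s hmem
    refine ⟨insert s C, by rw [Finset.card_insert_of_notMem hsC, hC], ?_⟩
    rw [Finset.coe_insert]
    refine hCd.insert fun D hD _ ↦ ⟨?_, hs D hD⟩
    rw [symmDiff_comm]
    exact hs D hD

theorem exists_code [Fintype ι] (t : ℕ)
    (h : Fintype.card ι * (Fintype.card α + 1) ^ t ≤ 2 ^ Fintype.card α) :
    ∃ c : ι → Finset α, ∀ i j, i ≠ j → t < (symmDiff (c i) (c j)).card := by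
  obtain ⟨C, hC, hCd⟩ := exists_code_finset t _ h
  have e : ι ≃ C := Fintype.equivOfCardEq (by simp [hC])
  exact ⟨fun i ↦ e i, fun i j hij ↦ hCd (e i).2 (e j).2 fun he ↦ hij (e.injective (Subtype.ext he))⟩

end Code

/-! ### Shrubs and the coloring for `Λ` -/

section Shrub

variable {Z α β : Type*} [Fintype Z] [DecidableEq α] [DecidableEq β] {k : ℕ}

open Classical in
/-- The vertex of the shrub on `Y` reached along the sequence `S` of elements of `Y`: it consists of
a codeword `D` for `Y` written with the bits `u` outside of `Y`, of the elements of `S`, and of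
the codewords of these elements, the `j`-th one written with the bits `v (j, ·)`. -/
noncomputable def shrubVertex (u : α × Bool → Z) (v : Fin k × β × Bool → Z) (D : Finset α)
    (d : Z → Finset β) (Y : Finset Z) (S : List Z) : Finset Z :=
  Finset.univ.filter fun z ↦ (z ∉ Y ∧ ∃ l, u (l, decide (l ∈ D)) = z) ∨ z ∈ S ∨
    ∃ (j : Fin k) (t : β) (y : Z), S[j.val]? = some y ∧ v (j, t, decide (t ∈ d y)) = z

variable {u : α × Bool → Z} {v : Fin k × β × Bool → Z} {D D' : Finset α} {d : Z → Finset β}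
  {Y Y' : Finset Z} {S S' : List Z} {z : Z}

theorem mem_shrubVertex : z ∈ shrubVertex u v D d Y S ↔
    (z ∉ Y ∧ ∃ l, u (l, decide (l ∈ D)) = z) ∨ z ∈ S ∨
      ∃ (j : Fin k) (t : β) (y : Z), S[j.val]? = some y ∧ v (j, t, decide (t ∈ d y)) = z := by
  simp only [shrubVertex, Finset.mem_filter, Finset.mem_univ, true_and]

theorem shrubVertex_mono (h : S <+: S') :
    shrubVertex u v D d Y S ⊆ shrubVertex u v D d Y S' := by
  intro z hz
  rw [mem_shrubVertex] at hz ⊢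
  refine hz.imp_right (Or.imp (fun hz ↦ h.subset hz) ?_)
  rintro ⟨j, t, y, hy, rfl⟩
  refine ⟨j, t, y, ?_, rfl⟩
  obtain ⟨R, rfl⟩ := h
  exact List.getElem?_append_left (List.getElem?_eq_some_iff.1 hy).1 ▸ hy

theorem mem_shrubVertex_of_mem (hv : ∀ x, v x ∉ Y) (hz : z ∈ Y) :
    z ∈ shrubVertex u v D d Y S ↔ z ∈ S := by
  rw [mem_shrubVertex]
  constructor
  · rintro (⟨hz', -⟩ | hS | ⟨j, t, y, -, rfl⟩)
    · exact absurd hz hz'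
    · exact hS
    · exact absurd hz (hv _)
  · exact fun h ↦ .inr (.inl h)

/-- The points of `v` come neither from `u` nor from `Y`, so each bit written for the `j`-th entry
of `S` must be written for the `j`-th entry of `S'`; injectivity of `d` then gives equal entries. -/
theorem prefix_of_shrubVertex_subset [Nonempty β] (hu : ∀ x y, u x ≠ v y)
    (hvi : Function.Injective v) (hv : ∀ x, v x ∉ Y) (hd : Function.Injective d)
    (hS' : ∀ y ∈ S', y ∈ Y) (hk : S.length ≤ k)
    (h : shrubVertex u v D d Y S ⊆ shrubVertex u v D' d Y S') : S <+: S' := by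
  rw [List.prefix_iff_getElem?]
  intro i hi
  have key (t : β) : ∃ y, S'[i]? = some y ∧ decide (t ∈ d y) = decide (t ∈ d S[i]) := by
    have := @h (v (⟨i, hi.trans_le hk⟩, t, decide (t ∈ d S[i]))) (mem_shrubVertex.2
      (.inr (.inr ⟨⟨i, hi.trans_le hk⟩, t, S[i], List.getElem?_eq_getElem hi, rfl⟩)))
    rcases mem_shrubVertex.1 this with ⟨-, l, hl⟩ | hmem | ⟨j, t', y, hy, he⟩
    · exact absurd hl (hu _ _)
    · exact absurd (hS' _ hmem) (hv _)
    · have he := hvi he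
      simp only [Prod.mk.injEq] at he
      obtain ⟨rfl, rfl, hb⟩ := he
      exact ⟨y, hy, hb⟩
  obtain ⟨y, hy, -⟩ := key (Classical.arbitrary β)
  rw [hy]
  congr 1
  refine hd (Finset.ext fun t ↦ ?_)
  obtain ⟨y', hy', hb⟩ := key t
  obtain rfl : y = y' := Option.some.inj (hy.symm.trans hy')
  simpa using hb

/-- Where `D` and `D'` differ, the point written for `D` must either be left out on the left, so lie
in `Y`, or be supplied on the right by `S'`, so lie in `Y'`. -/
theorem card_symmDiff_le_of_shrubVertex_subset [DecidableEq Z]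
    (hui : Function.Injective u) (hS' : ∀ y ∈ S', y ∈ Y')
    {v' : Fin k × β × Bool → Z} (hu' : ∀ x y, u x ≠ v' y)
    (h : shrubVertex u v D d Y S ⊆ shrubVertex u v' D' d Y' S') :
    (symmDiff D D').card ≤ (Y ∪ Y').card := by
  refine Finset.card_le_card_of_injOn (fun l ↦ u (l, decide (l ∈ D))) (fun l hl ↦ ?_)
    fun l _ l' _ hll ↦ congrArg Prod.fst (hui hll)
  by_contra hY
  simp only [Finset.coe_union, Set.mem_union, Finset.mem_coe, not_or] at hY
  have := h (mem_shrubVertex.2 (.inl ⟨hY.1, l, rfl⟩))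
  rcases mem_shrubVertex.1 this with ⟨-, l', hl'⟩ | hmem | ⟨j, t', y, hy, he⟩
  · have he := hui hl'
    simp only [Prod.mk.injEq] at he
    obtain ⟨rfl, hb⟩ := he
    rw [Finset.mem_coe, Finset.mem_symmDiff] at hl
    simp only [decide_eq_decide] at hb
    tauto
  · exact hY.2 (hS' _ hmem)
  · exact hu' _ _ he.symm

end Shrub

/-- A family of shrubs, one for each `k`-element set `Y`, whose vertices are pairwise incomparable
unless they lie on a common path; no red copy of `Q_n` avoids all of them. -/
theorem not_posetArrows_lambda {n k b : ℕ} (hb : 0 < b) (hkb : 8 * (k * b) ≤ n)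
    (hn : n + k ≤ 2 ^ b) : ¬ PosetArrows (n + k) PosetLambda (BooleanLattice n) := by
  classical
  let Z := Fin (n + k)
  have : NeZero b := ⟨hb.ne'⟩
  -- Distance above `2 * k` exceeds `(Y ∪ Y').card`. There are at most `2^(kb)` sets `Y` and each
  -- ball has size at most `2^(2kb)`, hence length `3kb`.
  obtain ⟨c, hc⟩ : ∃ c : {Y : Finset Z // Y.card = k} → Finset (Fin (3 * (k * b))),
      ∀ Y Y', Y ≠ Y' → 2 * k < (symmDiff (c Y) (c Y')).card := by
    refine exists_code (2 * k) ?_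
    have h1 : Fintype.card {Y : Finset Z // Y.card = k} ≤ (2 ^ b) ^ k := by
      rw [Fintype.card_finset_len, Fintype.card_fin]
      exact (Nat.choose_le_pow _ _).trans (Nat.pow_le_pow_left hn k)
    have h2 : 3 * (k * b) + 1 ≤ 2 ^ b := by
      have := Nat.one_le_two_pow (n := b)
      omega
    rw [Fintype.card_fin]
    calc _ ≤ (2 ^ b) ^ k * (2 ^ b) ^ (2 * k) := Nat.mul_le_mul h1 (Nat.pow_le_pow_left h2 _)
      _ = 2 ^ (3 * (k * b)) := by rw [← pow_add, ← pow_mul]; congr 1; ring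
  obtain ⟨d⟩ : Nonempty (Z ↪ Finset (Fin b)) :=
    Function.Embedding.nonempty_of_card_le (by simpa [Z] using hn)
  -- Two points per bit: `6kb` for `u`, common to all `Y`, and `2kb` for `v`, chosen outside `Y`.
  -- Together `8kb ≤ n`, the size of the complement of `Y`.
  obtain ⟨u⟩ : Nonempty (Fin (3 * (k * b)) × Bool ↪ Z) :=
    Function.Embedding.nonempty_of_card_le (by simp [Z]; omega)
  have hv (Y : {Y : Finset Z // Y.card = k}) : ∃ v : Fin k × Fin b × Bool → Z,
      Function.Injective v ∧ (∀ x, v x ∉ Y.1) ∧ ∀ x y, u x ≠ v y := by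
    obtain ⟨v⟩ : Nonempty (Fin k × Fin b × Bool ↪ ↥(Y.1 ∪ Finset.univ.map u)ᶜ) := by
      refine Function.Embedding.nonempty_of_card_le ?_
      have h1 := Finset.card_union_le Y.1 (Finset.univ.map u)
      have h2 := Finset.card_compl (Y.1 ∪ Finset.univ.map u)
      simp only [Finset.card_map, Finset.card_univ, Fintype.card_prod, Fintype.card_fin,
        Fintype.card_bool, Y.2, Fintype.card_coe, Z] at h1 h2 ⊢
      have h3 : k * (b * 2) = 2 * (k * b) := by ring
      omega
    have hmem (x) := Finset.mem_compl.1 (v x).2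
    simp only [Finset.mem_union, not_or] at hmem
    exact ⟨fun x ↦ v x, Subtype.val_injective.comp v.injective, fun x ↦ (hmem x).1,
      fun x y h ↦ (hmem y).2 ((show u x = v y from h) ▸ Finset.mem_map_of_mem u (Finset.mem_univ x))⟩
  choose v hvi hvY huv using hv
  let B (Y : {Y : Finset Z // Y.card = k}) (S : List Z) : Finset Z :=
    shrubVertex u (v Y) (c Y) d Y.1 S
  let blue (A : Finset Z) : Prop := ∃ Y S, S.Nodup ∧ (∀ y ∈ S, y ∈ Y.1) ∧ B Y S = A
  have hlen {Y : {Y : Finset Z // Y.card = k}} {S : List Z} (hS : S.Nodup)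
      (hSY : ∀ y ∈ S, y ∈ Y.1) : S.length ≤ k := by
    rw [← Y.2, ← List.toFinset_card_of_nodup hS]
    exact Finset.card_le_card fun y hy ↦ hSY y (List.mem_toFinset.1 hy)
  have hpre {Y Y' S S'} (hS : S.Nodup) (hSY : ∀ y ∈ S, y ∈ Y.1) (hSY' : ∀ y ∈ S', y ∈ Y'.1)
      (hle : B Y S ⊆ B Y' S') : Y = Y' ∧ S <+: S' := by
    obtain rfl : Y = Y' := by
      by_contra hne
      have h1 := hc Y Y' hne
      have h2 := card_symmDiff_le_of_shrubVertex_subset u.injective hSY' (huv Y') hle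
      have h3 := Finset.card_union_le Y.1 Y'.1
      rw [Y.2, Y'.2] at h3
      omega
    exact ⟨rfl, prefix_of_shrubVertex_subset (huv Y) (hvi Y) (hvY Y) d.injective hSY'
      (hlen hS hSY) hle⟩
  intro h
  rcases h fun A ↦ if blue A then .blue else .red with ⟨f, hf⟩ | ⟨φ, hφ⟩
  · have hf (x) : blue (f x) := by
      by_contra hx
      simpa [hx] using hf x
    obtain ⟨Y₁, S₁, -, hY₁, hB₁⟩ := hf .z₁
    obtain ⟨Y₂, S₂, hS₂, hY₂, hB₂⟩ := hf .z₂
    obtain ⟨Y₃, S₃, hS₃, hY₃, hB₃⟩ := hf .z₃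
    have h₂ : f .z₂ ≤ f .z₁ := f.le_iff_le.2 (.inr rfl)
    have h₃ : f .z₃ ≤ f .z₁ := f.le_iff_le.2 (.inr rfl)
    rw [← hB₁, ← hB₂] at h₂
    rw [← hB₁, ← hB₃] at h₃
    obtain ⟨rfl, hp₂⟩ := hpre hS₂ hY₂ hY₁ h₂
    obtain ⟨rfl, hp₃⟩ := hpre hS₃ hY₃ hY₁ h₃
    -- Two prefixes of one sequence are comparable, unlike `z₂` and `z₃`.
    rcases List.prefix_or_prefix_of_prefix hp₂ hp₃ with hp | hp
    · have : f .z₂ ≤ f .z₃ := hB₂ ▸ hB₃ ▸ shrubVertex_mono hp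
      rcases f.le_iff_le.1 this with h | h <;> cases h
    · have : f .z₃ ≤ f .z₂ := hB₂ ▸ hB₃ ▸ shrubVertex_mono hp
      rcases f.le_iff_le.1 this with h | h <;> cases h
  · have hφ (A) : ¬ blue (φ A) := fun hx ↦ by simpa [hx] using hφ A
    -- The point `x i` will detect `i`: it lies in `φ A` exactly when `i ∈ A`.
    have hx (i : Fin n) : ∃ x, x ∈ φ {i} ∧ x ∉ φ {i}ᶜ := by
      by_contra! hcon
      have : φ {i} ≤ φ {i}ᶜ := hcon
      rw [φ.le_iff_le] at this
      simpa using @this i (by simp)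
    choose x hx₁ hx₂ using hx
    have hxA (A : Finset (Fin n)) (i : Fin n) : x i ∈ φ A ↔ i ∈ A := by
      constructor
      · intro hi
        by_contra hiA
        have : φ A ≤ φ {i}ᶜ := φ.monotone fun a ha ↦ by
          simp only [Finset.mem_compl, Finset.mem_singleton]
          rintro rfl
          exact hiA ha
        exact hx₂ i (this hi)
      · intro hi
        have : φ {i} ≤ φ A := φ.monotone (Finset.singleton_subset_iff.2 hi)
        exact this (hx₁ i)
    have hxi : Function.Injective x := fun i j hij ↦ by
      have := (hxA {i} j).1 (hij ▸ hx₁ i)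
      exact (Finset.mem_singleton.1 this).symm
    let Y : {Y : Finset Z // Y.card = k} := ⟨(Finset.univ.image x)ᶜ, by
      rw [Finset.card_compl, Finset.card_image_of_injective _ hxi]
      simp [Z]⟩
    have hY (z : Z) : z ∉ Y.1 ↔ ∃ i, x i = z := by simp [Y]
    let a (S : List Z) : Finset (Fin n) := Finset.univ.filter fun i ↦ x i ∈ B Y S
    -- `φ (a S)` agrees with `B Y S` off `Y` and contains `S`. Being red, it differs from `B Y S`,
    -- so it holds some `y ∈ Y` outside `S`, by which `S` is extended.
    have key (i : ℕ) : ∃ S : List Z, S.Nodup ∧ (∀ y ∈ S, y ∈ Y.1) ∧ S.length = i ∧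
        ∀ y ∈ S, y ∈ φ (a S) := by
      induction i with
      | zero => exact ⟨[], by simp⟩
      | succ i ih =>
        obtain ⟨S, hS, hSY, hSi, hSφ⟩ := ih
        obtain ⟨y, hyY, hyφ, hyS⟩ : ∃ y ∈ Y.1, y ∈ φ (a S) ∧ y ∉ S := by
          by_contra! hcon
          refine hφ (a S) ⟨Y, S, hS, hSY, Finset.ext fun z ↦ ?_⟩
          by_cases hz : z ∈ Y.1
          · rw [mem_shrubVertex_of_mem (hvY Y) hz]
            exact ⟨hSφ z, hcon z hz⟩
          · obtain ⟨j, rfl⟩ := (hY z).1 hz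
            rw [hxA]
            simp [a]
        have hle : φ (a S) ≤ φ (a (S ++ [y])) := φ.monotone fun j hj ↦ by
          simp only [a, Finset.mem_filter, Finset.mem_univ, true_and] at hj ⊢
          exact shrubVertex_mono (List.prefix_append S [y]) hj
        refine ⟨S ++ [y], ?_, ?_, by simp [hSi], ?_⟩
        · rw [List.nodup_append]
          refine ⟨hS, by simp, fun z hz w hw ↦ ?_⟩
          rw [List.mem_singleton] at hw
          rintro rfl
          exact hyS (hw ▸ hz)
        · intro z hz
          rcases List.mem_append.1 hz with hz | hz
          · exact hSY z hz
          · exact List.mem_singleton.1 hz ▸ hyY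
        · intro z hz
          rcases List.mem_append.1 hz with hz | hz
          · exact hle (hSφ z hz)
          · exact List.mem_singleton.1 hz ▸ hle hyφ
    obtain ⟨S, hS, hSY, hSk, -⟩ := key (k + 1)
    have := hlen hS hSY
    omega

/-! ### Duality between `V` and `Λ` -/

theorem HasMonoCopy.lambda_of_compl_v {N : ℕ} {c : BooleanLattice N → Color} {k : Color}
    (h : HasMonoCopy (fun A ↦ c Aᶜ) k PosetV) : HasMonoCopy c k PosetLambda := by
  obtain ⟨f, hf⟩ := h
  refine ⟨OrderEmbedding.ofMapLEIff (fun z : PosetLambda ↦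
    (f (match z with | .z₁ => .z₁ | .z₂ => .z₂ | .z₃ => .z₃))ᶜ) fun x y ↦ ?_, fun x ↦ hf _⟩
  rw [compl_le_compl_iff_le, f.le_iff_le]
  change (_ = _ ∨ _ = PosetV.z₁) ↔ (x = y ∨ y = PosetLambda.z₁)
  cases x <;> cases y <;> simp

theorem HasMonoCopy.booleanLattice_of_compl {N n : ℕ} {c : BooleanLattice N → Color} {k : Color}
    (h : HasMonoCopy (fun A ↦ c Aᶜ) k (BooleanLattice n)) :
    HasMonoCopy c k (BooleanLattice n) := by
  obtain ⟨f, hf⟩ := h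
  exact ⟨OrderEmbedding.ofMapLEIff (fun A ↦ (f Aᶜ)ᶜ) fun A B ↦ by
    rw [compl_le_compl_iff_le, f.le_iff_le, compl_le_compl_iff_le], fun A ↦ hf _⟩

theorem PosetArrows.lambda_of_v {N n : ℕ} (h : PosetArrows N PosetV (BooleanLattice n)) :
    PosetArrows N PosetLambda (BooleanLattice n) := fun c ↦
  (h fun A ↦ c Aᶜ).imp HasMonoCopy.lambda_of_compl_v HasMonoCopy.booleanLattice_of_compl

theorem PosetArrows.lambda_of_not_isTrivialPoset {P : Type*} [PartialOrder P] {N n : ℕ}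
    (hP : ¬ IsTrivialPoset P)
    (h : PosetArrows N P (BooleanLattice n)) : PosetArrows N PosetLambda (BooleanLattice n) := by
  rw [IsTrivialPoset, not_and_or, not_not, not_not] at hP
  rcases hP with ⟨⟨f⟩⟩ | ⟨⟨f⟩⟩
  · exact fun c ↦ (h c).imp_left (.mono f)
  · exact PosetArrows.lambda_of_v fun c ↦ (h c).imp_left (.mono f)

/-! ### Numerical bounds and asymptotics -/

section Bounds

variable {P : Type*} [PartialOrder P] [Finite P]

theorem le_posetRamsey_of_not_isTrivialPoset (hP : ¬ IsTrivialPoset P) {n : ℕ}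
    (hn : 2 ^ 16 ≤ n) :
    (n : ℝ) + (1 / 15 : ℝ) * ((n : ℝ) / Real.logb 2 (n : ℝ)) ≤
      (posetRamsey P (BooleanLattice n) : ℝ) := by
  set l := Real.logb 2 (n : ℝ) with hl
  have hn0 : (0 : ℝ) < n := by
    have : 0 < n := by omega
    exact_mod_cast this
  have hl16 : 16 ≤ l := by
    rw [hl, Real.le_logb_iff_rpow_le (by norm_num) hn0]
    exact_mod_cast hn
  set r : ℝ := (1 / 15 : ℝ) * ((n : ℝ) / l) with hr
  have hr0 : 0 < r := by positivity
  have hrl : 15 * (r * l) = n := by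
    rw [hr]
    field_simp
  obtain ⟨k, hk⟩ : ∃ k, ⌈r⌉₊ = k + 1 :=
    Nat.exists_eq_succ_of_ne_zero (Nat.ceil_pos.2 hr0).ne'
  have hkr : (k : ℝ) < r := Nat.lt_ceil.1 (by omega)
  have hlog : (Nat.log 2 n : ℝ) ≤ l := Real.natLog_le_logb n 2
  -- Take `b = Nat.log 2 n + 2`. As `l ≥ 16`, `b ≤ 9/8 * l`, so the left side is at most `9 * (r *
  -- l)`, while `n = 15 * (r * l)`.
  have hkb : 8 * (k * (Nat.log 2 n + 2)) ≤ n := by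
    have h : (8 * (k * (Nat.log 2 n + 2)) : ℝ) ≤ n := by
      have h1 : (k * (Nat.log 2 n + 2) : ℝ) ≤ r * (9 / 8 * l) :=
        mul_le_mul hkr.le (by linarith) (by positivity) hr0.le
      have h2 : 0 ≤ r * l := by positivity
      linarith
    exact_mod_cast h
  have hpow : n + k ≤ 2 ^ (Nat.log 2 n + 2) := by
    have h1 := Nat.lt_pow_succ_log_self (b := 2) (by norm_num) n
    have h2 : k ≤ k * (Nat.log 2 n + 2) := Nat.le_mul_of_pos_right k (by omega)
    rw [pow_succ] at h1 ⊢
    omega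
  have hlt : n + k < posetRamsey P (BooleanLattice n) := lt_posetRamsey fun h ↦
    not_posetArrows_lambda (by omega) hkb hpow (h.lambda_of_not_isTrivialPoset hP)
  have hceil : r ≤ k + 1 := by exact_mod_cast hk ▸ Nat.le_ceil r
  have : (n + k + 1 : ℝ) ≤ posetRamsey P (BooleanLattice n) := by exact_mod_cast hlt
  linarith

theorem IsTrivialPoset.posetRamsey_le [Nonempty P] (hP : IsTrivialPoset P) (n : ℕ) :
    posetRamsey P (BooleanLattice n) ≤
      n + posetHeight P + spernerNumber (posetWidth P) - 1 :=
  (hP.isParallelCompositionOfChains.posetArrows n).posetRamsey_le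

theorem IsTrivialPoset.posetRamsey_sub_isBigO [Nonempty P] (hP : IsTrivialPoset P) :
    (fun n : ℕ ↦ (posetRamsey P (BooleanLattice n) : ℝ) - (n : ℝ))
      =O[atTop] (fun _ : ℕ ↦ (1 : ℝ)) := by
  refine IsBigO.of_bound (posetHeight P + spernerNumber (posetWidth P) : ℝ) ?_
  filter_upwards [eventually_ge_atTop 1] with n hn
  have h1 : n ≤ posetRamsey P (BooleanLattice n) := by
    have := height_le_posetRamsey (P := P) hn
    have := posetHeight_pos P
    omega
  have h2 : posetRamsey P (BooleanLattice n) ≤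
      n + posetHeight P + spernerNumber (posetWidth P) :=
    (hP.posetRamsey_le n).trans (Nat.sub_le _ _)
  have h1 : (n : ℝ) ≤ posetRamsey P (BooleanLattice n) := by exact_mod_cast h1
  have h2 : (posetRamsey P (BooleanLattice n) : ℝ) ≤
      n + posetHeight P + spernerNumber (posetWidth P) := by exact_mod_cast h2
  rw [Real.norm_eq_abs, abs_of_nonneg (by linarith), norm_one]
  linarith

theorem one_isBigO_posetRamsey_sub (hP : 2 ≤ Nat.card P) :
    (fun _ : ℕ ↦ (1 : ℝ))
      =O[atTop] (fun n : ℕ ↦ (posetRamsey P (BooleanLattice n) : ℝ) - (n : ℝ)) := by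
  refine IsBigO.of_bound 1 (Eventually.of_forall fun n ↦ ?_)
  have h : (n + 1 : ℝ) ≤ posetRamsey P (BooleanLattice n) := by
    exact_mod_cast lt_posetRamsey_of_two_le_card hP n
  rw [norm_one, one_mul, Real.norm_eq_abs]
  exact le_trans (by linarith) (le_abs_self _)

end Bounds

theorem not_isTrivialPoset_lambda : ¬ IsTrivialPoset PosetLambda := fun h ↦
  h.1 ⟨RelEmbedding.refl _⟩

theorem finite_posetLambda : Finite PosetLambda :=
  Finite.of_surjective (fun i : Fin 3 ↦ ![PosetLambda.z₁, .z₂, .z₃] i) fun x ↦ by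
    cases x
    exacts [⟨0, rfl⟩, ⟨1, rfl⟩, ⟨2, rfl⟩]

theorem mainTheorem1 :
    (∀ (P : Type*) [PartialOrder P] [Finite P] [Nonempty P],
      (IsTrivialPoset P ↔ IsParallelCompositionOfChains P) ∧
      (IsTrivialPoset P →
        (∀ n : ℕ, 1 ≤ n →
          n + posetHeight P - 1 ≤ posetRamsey P (BooleanLattice n) ∧
          posetRamsey P (BooleanLattice n) ≤
            n + posetHeight P + spernerNumber (posetWidth P) - 1) ∧
        ((fun n : ℕ ↦ (posetRamsey P (BooleanLattice n) : ℝ) - (n : ℝ))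
          =O[atTop] (fun _ : ℕ ↦ (1 : ℝ))) ∧
        (2 ≤ Nat.card P →
          (fun n : ℕ ↦ (posetRamsey P (BooleanLattice n) : ℝ) - (n : ℝ))
            =Θ[atTop] (fun _ : ℕ ↦ (1 : ℝ)))) ∧
      (¬ IsTrivialPoset P →
        ∀ n : ℕ, 2 ^ 16 ≤ n →
          (n : ℝ) + (1 / 15 : ℝ) * ((n : ℝ) / Real.logb 2 (n : ℝ)) ≤
            (posetRamsey P (BooleanLattice n) : ℝ))) ∧
    (∀ n : ℕ, 2 ^ 16 ≤ n →
      (n : ℝ) + (1 / 15 : ℝ) * ((n : ℝ) / Real.logb 2 (n : ℝ)) ≤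
        (posetRamsey PosetLambda (BooleanLattice n) : ℝ)) := by
  refine ⟨fun P _ _ _ ↦ ⟨⟨fun h ↦ h.isParallelCompositionOfChains, fun h ↦ h.isTrivialPoset⟩,
    fun h ↦ ⟨fun n hn ↦ ⟨height_le_posetRamsey hn, h.posetRamsey_le n⟩, h.posetRamsey_sub_isBigO,
      fun hP ↦ ⟨h.posetRamsey_sub_isBigO, one_isBigO_posetRamsey_sub hP⟩⟩,
    fun h n hn ↦ le_posetRamsey_of_not_isTrivialPoset h hn⟩, fun n hn ↦ ?_⟩
  have := finite_posetLambda
  exact le_posetRamsey_of_not_isTrivialPoset not_isTrivialPoset_lambda hn
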